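/- Let $p\ge 1$ be an integer. For $\theta\in[-\pi,\pi]$ put $$M_p(\theta)=(2-2\cos\theta)^{p+1}\sum_{j\in\mathbb Z}\frac{1}{(\theta+2j\pi)^{2p+2}},\qquad B_p(\theta)=-(2-2\cos\theta)^{p+1}\sum_{j\in\mathbb Z}\frac{1}{(\theta+2j\pi)^{2p}},\qquad D_p(\theta)=(-1)^p(2-2\cos\theta)^p,$$ where at the removable singularity $\theta=0$ the limit values $M_p(0)=1$ and $B_p(0)=0$ are taken; the same formulas extend these functions $2\pi$-periodically and smoothly to $\mathbb R$, and derivatives are those of the extensions. Let $$F_p(\theta;\rho,\delta)=B_p(\theta)+\rho\bigl(M_p(\theta)+\delta(-1)^pD_p(\theta)\bigr),\qquad \delta_p=-\frac{M_p(\pi)}{(-1)^pD_p(\pi)},\qquad \rho_p=-\frac{B_p(\pi)}{M_p(\pi)}.$$ Then the following hold. 1. For every $\delta\in\mathbb R$: the function $\theta\mapsto F_p(\theta;\rho,\delta)$ has, for all $\rho>0$, exactly two zeros in $[-\pi,\pi]$, both of them simple, if and only if $\delta\le\delta_p$. 2. For every $\rho>0$: the function $\theta\mapsto F_p(\theta;\rho,0)$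 has exactly two distinct zeros in $[-\pi,\pi]$ if and only if $\rho\le\rho_p$; and it has exactly two zeros in $[-\pi,\pi]$, both of them simple, if and only if $\rho<\rho_p$. In the borderline case $\rho=\rho_p$ the zeros in $[-\pi,\pi]$ are exactly $\theta=\pm\pi$ (the same point of the circle $\mathbb R/2\pi\mathbb Z$), and there the first derivative of $F_p(\cdot;\rho_p,0)$ vanishes and the second does not. 3. For all $\rho>0$ and $\delta\le0$, the function $\theta\mapsto F_p(\theta;\rho,\delta)/M_p(\theta)$ is strictly decreasing on $(0,\pi)$. -/

import Mathlib

noncomputable section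

namespace SplineSymbol

/-- `M_p(θ) = (2 - 2 cos θ)^(p+1) ∑_{j ∈ ℤ} 1 / (θ + 2 j π)^(2p+2)`, with the limit value `1` at the
removable singularities `θ ∈ 2πℤ` (in `[-π, π]` this is only `θ = 0`). -/
def M (p : ℕ) (θ : ℝ) : ℝ :=
  if Real.cos θ = 1 then 1
  else (2 - 2 * Real.cos θ) ^ (p + 1) *
    ∑' j : ℤ, 1 / (θ + 2 * (j : ℝ) * Real.pi) ^ (2 * p + 2)

/-- `B_p(θ) = -(2 - 2 cos θ)^(p+1) ∑_{j ∈ ℤ} 1 / (θ + 2 j π)^(2p)`, with the limit value `0` at the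
removable singularities `θ ∈ 2πℤ`. -/
def B (p : ℕ) (θ : ℝ) : ℝ :=
  if Real.cos θ = 1 then 0
  else -((2 - 2 * Real.cos θ) ^ (p + 1) *
    ∑' j : ℤ, 1 / (θ + 2 * (j : ℝ) * Real.pi) ^ (2 * p))

/-- `D_p(θ) = (-1)^p (2 - 2 cos θ)^p`. -/
def D (p : ℕ) (θ : ℝ) : ℝ :=
  (-1) ^ p * (2 - 2 * Real.cos θ) ^ p

/-- `F_p(θ; ρ, δ) = B_p(θ) + ρ (M_p(θ) + δ (-1)^p D_p(θ))`. -/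
def F (p : ℕ) (ρ δ θ : ℝ) : ℝ :=
  B p θ + ρ * (M p θ + δ * (-1) ^ p * D p θ)

/-- `δ_p = - M_p(π) / ((-1)^p D_p(π))`. -/
def deltaCrit (p : ℕ) : ℝ :=
  -(M p Real.pi / ((-1) ^ p * D p Real.pi))

/-- `ρ_p = - B_p(π) / M_p(π)`. -/
def rhoCrit (p : ℕ) : ℝ :=
  -(B p Real.pi / M p Real.pi)

/-- The set of zeros of `f` in `[-π, π]`. -/
def zerosOn (f : ℝ → ℝ) : Set ℝ :=
  {θ | θ ∈ Set.Icc (-Real.pi) Real.pi ∧ f θ = 0}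

/-- `f` has exactly two distinct zeros in `[-π, π]`. -/
def HasExactlyTwoZeros (f : ℝ → ℝ) : Prop :=
  (zerosOn f).encard = 2

/-- `f` has exactly two zeros in `[-π, π]`, and both are simple. -/
def HasExactlyTwoSimpleZeros (f : ℝ → ℝ) : Prop :=
  HasExactlyTwoZeros f ∧ ∀ θ ∈ zerosOn f, deriv f θ ≠ 0

end SplineSymbol

end

namespace SplineSymbol

open Real Set

/-! Write S_n for the lattice sum and w = 2 - 2 cos θ. Since S_2 = 1/w, the term w^p equals w^(p+1)
S_2, so all three symbols are lattice sums times w^(p+1), and F = M · R with R = ρ - S_{2p}/S_{2p+2}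
+ ρδ S_2/S_{2p+2} (`symbolRatio`).

The heart is that S_{2k}/S_{2k+2} increases strictly on (0, π). As S_n' = -n S_{n+1}, its derivative
has the sign of a Wronskian that vanishes at π, where odd sums are zero, and decreases by
Cauchy–Schwarz (`latticeSum_wronskian_pos`). The ratio S_2/S_{2p+2} is a product of such ratios, so
R is strictly decreasing for δ ≤ 0.

Near 0 the function R is positive, so the sign of R(π) decides whether there is a zero in (0, π),
necessarily simple; evenness of F supplies the other one. Evenness and periodicity force F'(π) = 0,
so a zero at π is never simple. If δ > δ_p, some ρ > 0 produces such a zero. The thresholds are the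
parameters at which F(π) changes sign. -/

/-- The lattice sum `∑_{j ∈ ℤ} 1 / (θ + 2 j π)^n`. -/
noncomputable def latticeSum (n : ℕ) (θ : ℝ) : ℝ :=
  ∑' j : ℤ, 1 / (θ + 2 * (j : ℝ) * π) ^ n

/-! ### Lattice sums: convergence, derivatives, symmetries, Cauchy–Schwarz -/

/-- Linear growth in j, uniform for θ at distance at least ε from 0 and 2π. It supplies the
majorants for termwise differentiation. -/
lemma mul_abs_add_one_le_abs_shift {ε θ : ℝ} (h0 : 0 < ε) (h1 : ε ≤ θ) (h2 : θ ≤ 2 * π - ε)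
    (j : ℤ) : ε / 2 * (|(j : ℝ)| + 1) ≤ |θ + 2 * (j : ℝ) * π| := by
  have hε : ε ≤ π := by linarith
  rcases le_or_gt 0 j with hj | hj
  · have hj' : (0 : ℝ) ≤ j := by exact_mod_cast hj
    rw [abs_of_nonneg hj']
    refine le_trans ?_ (le_abs_self _)
    nlinarith [mul_le_mul_of_nonneg_right hε hj']
  · have hj' : (j : ℝ) ≤ -1 := by exact_mod_cast (by omega : j ≤ -1)
    rw [abs_of_neg (by linarith : (j : ℝ) < 0)]
    refine le_trans ?_ (neg_le_abs _)
    nlinarith [mul_nonneg (by linarith : (0 : ℝ) ≤ 4 * π - ε) (by linarith : (0 : ℝ) ≤ -1 - j)]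

lemma shift_ne_zero {θ : ℝ} (hθ : θ ∈ Ioo 0 (2 * π)) (j : ℤ) : θ + 2 * (j : ℝ) * π ≠ 0 := by
  have hε : 0 < min θ (2 * π - θ) := lt_min hθ.1 (by linarith [hθ.2])
  have h := mul_abs_add_one_le_abs_shift hε (min_le_left _ _)
    (by linarith [min_le_right θ (2 * π - θ)]) j
  have : 0 < min θ (2 * π - θ) / 2 * (|(j : ℝ)| + 1) := by positivity
  exact abs_pos.1 (this.trans_le h)

lemma summable_one_div_abs_int_add_one_pow {n : ℕ} (hn : 2 ≤ n) :
    Summable fun j : ℤ => 1 / (|(j : ℝ)| + 1) ^ n := by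
  have h : Summable fun m : ℕ => 1 / ((m : ℝ) + 1) ^ n := by
    have := (summable_nat_add_iff 1).mpr (Real.summable_one_div_nat_pow.mpr (by omega : 1 < n))
    simpa using this
  apply Summable.of_nat_of_neg <;> simpa using h

lemma abs_one_div_shift_pow_le {ε θ : ℝ} (h0 : 0 < ε) (h1 : ε ≤ θ) (h2 : θ ≤ 2 * π - ε)
    (n : ℕ) (j : ℤ) :
    |1 / (θ + 2 * (j : ℝ) * π) ^ n| ≤ (2 / ε) ^ n * (1 / (|(j : ℝ)| + 1) ^ n) := by
  have h := mul_abs_add_one_le_abs_shift h0 h1 h2 j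
  have hp : 0 < ε / 2 * (|(j : ℝ)| + 1) := by positivity
  rw [abs_div, abs_one, abs_pow]
  calc 1 / |θ + 2 * (j : ℝ) * π| ^ n ≤ 1 / (ε / 2 * (|(j : ℝ)| + 1)) ^ n := by gcongr
    _ = (2 / ε) ^ n * (1 / (|(j : ℝ)| + 1) ^ n) := by
      rw [mul_pow, one_div, mul_inv, ← inv_pow, inv_div, one_div]

lemma summable_latticeSum {n : ℕ} (hn : 2 ≤ n) {θ : ℝ} (hθ : θ ∈ Ioo 0 (2 * π)) :
    Summable fun j : ℤ => 1 / (θ + 2 * (j : ℝ) * π) ^ n := by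
  have hε : 0 < min θ (2 * π - θ) := lt_min hθ.1 (by linarith [hθ.2])
  refine Summable.of_norm_bounded ((summable_one_div_abs_int_add_one_pow hn).mul_left _)
    (fun j => abs_one_div_shift_pow_le hε (min_le_left _ _)
      (by linarith [min_le_right θ (2 * π - θ)]) n j)

lemma hasDerivAt_one_div_shift_pow (n : ℕ) {θ c : ℝ} (h : θ + c ≠ 0) :
    HasDerivAt (fun x => 1 / (x + c) ^ n) (-n * (1 / (θ + c) ^ (n + 1))) θ := by
  have h1 : HasDerivAt (fun x => ((x + c) ^ n)⁻¹) _ θ :=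
    (((hasDerivAt_id θ).add_const c).pow n).inv (pow_ne_zero n h)
  simp only [one_div]
  refine h1.congr_deriv ?_
  rcases n with _ | n
  · simp
  · simp only [id, Nat.add_sub_cancel, Pi.pow_apply]
    field_simp
    ring

lemma hasDerivAt_latticeSum {n : ℕ} (hn : 2 ≤ n) {θ : ℝ} (hθ : θ ∈ Ioo 0 (2 * π)) :
    HasDerivAt (latticeSum n) (-n * latticeSum (n + 1) θ) θ := by
  obtain ⟨ε, hε, hεθ⟩ := exists_between (lt_min hθ.1 (by linarith [hθ.2] : 0 < 2 * π - θ))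
  rw [lt_min_iff] at hεθ
  have hmem : θ ∈ Ioo ε (2 * π - ε) := ⟨hεθ.1, by linarith [hεθ.2]⟩
  have hsub : ∀ y ∈ Ioo ε (2 * π - ε), y ∈ Ioo 0 (2 * π) := fun y hy =>
    ⟨hε.trans hy.1, by linarith [hy.2]⟩
  have h := hasDerivAt_tsum_of_isPreconnected
    (g := fun (j : ℤ) (x : ℝ) => 1 / (x + 2 * (j : ℝ) * π) ^ n)
    (g' := fun (j : ℤ) (x : ℝ) => -n * (1 / (x + 2 * (j : ℝ) * π) ^ (n + 1)))
    (u := fun j : ℤ => n * ((2 / ε) ^ (n + 1) * (1 / (|(j : ℝ)| + 1) ^ (n + 1))))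
    (((summable_one_div_abs_int_add_one_pow (by omega)).mul_left _).mul_left _)
    isOpen_Ioo isPreconnected_Ioo
    (fun j y hy => hasDerivAt_one_div_shift_pow n (shift_ne_zero (hsub y hy) j))
    (fun j y hy => by
      rw [norm_mul, norm_neg, Real.norm_natCast]
      exact mul_le_mul_of_nonneg_left
        (abs_one_div_shift_pow_le hε hy.1.le hy.2.le (n + 1) j) (Nat.cast_nonneg n))
    hmem (summable_latticeSum hn hθ) hmem
  rw [tsum_mul_left] at h
  exact h

lemma latticeSum_add_two_pi (n : ℕ) (θ : ℝ) : latticeSum n (θ + 2 * π) = latticeSum n θ := by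
  unfold latticeSum
  rw [← (Equiv.addRight (1 : ℤ)).tsum_eq fun j : ℤ => 1 / (θ + 2 * (j : ℝ) * π) ^ n]
  refine tsum_congr fun j => ?_
  simp only [Equiv.coe_addRight, Int.cast_add, Int.cast_one]
  ring_nf

lemma latticeSum_neg (n : ℕ) (θ : ℝ) : latticeSum n (-θ) = (-1) ^ n * latticeSum n θ := by
  unfold latticeSum
  rw [← (Equiv.neg ℤ).tsum_eq fun j : ℤ => 1 / (-θ + 2 * (j : ℝ) * π) ^ n, ← tsum_mul_left]
  refine tsum_congr fun j => ?_
  have : -θ + 2 * ((Equiv.neg ℤ j : ℤ) : ℝ) * π = -1 * (θ + 2 * (j : ℝ) * π) := by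
    simp only [Equiv.neg_apply, Int.cast_neg]; ring
  rw [this, mul_pow, one_div, mul_inv, ← inv_pow, one_div]
  norm_num

/-- The points π and -π agree modulo the period, while an odd-order sum is an odd function. -/
lemma latticeSum_odd_pi {n : ℕ} (hn : Odd n) : latticeSum n π = 0 := by
  have h := latticeSum_neg n (-π)
  rw [hn.neg_one_pow, neg_neg, ← latticeSum_add_two_pi n (-π),
    show -π + 2 * π = π by ring] at h
  linarith

lemma latticeSum_even_neg (k : ℕ) (θ : ℝ) :
    latticeSum (2 * k) (-θ) = latticeSum (2 * k) θ := by
  rw [latticeSum_neg, (even_two_mul k).neg_one_pow, one_mul]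

lemma one_div_pow_two_mul_nonneg (k : ℕ) (x : ℝ) : 0 ≤ 1 / x ^ (2 * k) :=
  one_div_nonneg.2 ((even_two_mul k).pow_nonneg x)

lemma one_div_pow_le_latticeSum {k : ℕ} (hk : 1 ≤ k) {θ : ℝ} (hθ : θ ∈ Ioo 0 (2 * π)) :
    1 / θ ^ (2 * k) ≤ latticeSum (2 * k) θ := by
  have h := (summable_latticeSum (by omega : 2 ≤ 2 * k) hθ).le_tsum 0
    fun j _ => one_div_pow_two_mul_nonneg k _
  simpa [latticeSum] using h

lemma latticeSum_even_pos {k : ℕ} (hk : 1 ≤ k) {θ : ℝ} (hθ : θ ∈ Ioo 0 (2 * π)) :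
    0 < latticeSum (2 * k) θ :=
  (one_div_pos.2 (pow_pos hθ.1 _)).trans_le (one_div_pow_le_latticeSum hk hθ)

/-- Cauchy–Schwarz for consecutive even lattice sums. -/
lemma latticeSum_sq_le {k : ℕ} (hk : 1 ≤ k) {θ : ℝ} (hθ : θ ∈ Ioo 0 (2 * π)) :
    latticeSum (2 * k + 2) θ ^ 2 ≤ latticeSum (2 * k) θ * latticeSum (2 * k + 4) θ := by
  have hpos := latticeSum_even_pos hk hθ
  -- Summand by summand this is x^(-2k) (x^(-2) - t)^2 ≥ 0.
  have hquad : ∀ t : ℝ, 0 ≤ latticeSum (2 * k + 4) θ - 2 * t * latticeSum (2 * k + 2) θ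
      + t ^ 2 * latticeSum (2 * k) θ := by
    intro t
    have h0 := (summable_latticeSum (by omega : 2 ≤ 2 * k) hθ).mul_left (t ^ 2)
    have h2 := (summable_latticeSum (by omega : 2 ≤ 2 * k + 2) hθ).mul_left (2 * t)
    have h4 := summable_latticeSum (by omega : 2 ≤ 2 * k + 4) hθ
    unfold latticeSum
    rw [← tsum_mul_left, ← tsum_mul_left, ← h4.tsum_sub h2, ← (h4.sub h2).tsum_add h0]
    refine tsum_nonneg fun j => ?_
    have hx := shift_ne_zero hθ j
    generalize θ + 2 * (j : ℝ) * π = x at hx ⊢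
    have : 1 / x ^ (2 * k + 4) - 2 * t * (1 / x ^ (2 * k + 2)) + t ^ 2 * (1 / x ^ (2 * k))
        = 1 / x ^ (2 * k) * (1 / x ^ 2 - t) ^ 2 := by
      rw [pow_add, pow_add]; field_simp; ring
    rw [this]
    exact mul_nonneg (one_div_pow_two_mul_nonneg k x) (sq_nonneg _)
  -- The value of t that minimises the quadratic.
  have h := hquad (latticeSum (2 * k + 2) θ / latticeSum (2 * k) θ)
  field_simp at h
  nlinarith

/-! ### Closed form of the second lattice sum -/

/-- The partial fraction series of the cotangent at θ/(2π). The terms ±(n+1) stay paired because the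
order-one sum does not converge absolutely; the exponent 1 is kept so that
`hasDerivAt_one_div_shift_pow` applies. -/
lemma cot_half_series {θ : ℝ} (hθ : θ ∈ Ioo 0 (2 * π)) :
    cot (θ / 2) / 2 - 1 / θ =
      ∑' n : ℕ, (1 / (θ + 2 * ((-((n : ℤ) + 1) : ℤ) : ℝ) * π) ^ 1
        + 1 / (θ + 2 * (((n : ℤ) + 1 : ℤ) : ℝ) * π) ^ 1) := by
  have hπ := pi_pos
  have hx : ((θ / (2 * π) : ℝ) : ℂ) ∈ Complex.integerComplement := by
    rintro ⟨m, hm⟩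
    have hm' : (m : ℝ) = θ / (2 * π) := by exact_mod_cast hm
    apply shift_ne_zero hθ (-m)
    push_cast
    rw [hm']
    field_simp
    ring
  have h := cot_series_rep' hx
  have h' : π * cot (π * (θ / (2 * π))) - 1 / (θ / (2 * π)) =
      ∑' n : ℕ, (1 / (θ / (2 * π) - (n + 1)) + 1 / (θ / (2 * π) + (n + 1))) := by
    apply Complex.ofReal_injective
    rw [Complex.ofReal_tsum]
    push_cast at h ⊢
    exact h
  have e1 : π * (θ / (2 * π)) = θ / 2 := by field_simp
  have hθ0 := hθ.1.ne'
  calc cot (θ / 2) / 2 - 1 / θ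
      = (1 / (2 * π)) * (π * cot (π * (θ / (2 * π))) - 1 / (θ / (2 * π))) := by
        rw [e1]; field_simp
    _ = _ := by
        rw [h', ← tsum_mul_left]
        refine tsum_congr fun n => ?_
        have key : ∀ c : ℝ, 1 / (2 * π) * (1 / (θ / (2 * π) + c)) = 1 / (θ + 2 * c * π) := by
          intro c
          rw [div_mul_div_comm, one_mul]
          congr 1
          field_simp
        rw [mul_add, sub_eq_add_neg, key, key]
        push_cast
        simp only [pow_one]

lemma two_sub_two_cos (θ : ℝ) : 2 - 2 * cos θ = 4 * sin (θ / 2) ^ 2 := by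
  rw [sin_sq_eq_half_sub, show 2 * (θ / 2) = θ by ring]; ring

lemma sin_half_pos {θ : ℝ} (hθ : θ ∈ Ioo 0 (2 * π)) : 0 < sin (θ / 2) :=
  sin_pos_of_pos_of_lt_pi (by linarith [hθ.1]) (by linarith [hθ.2])

lemma two_sub_two_cos_pos {θ : ℝ} (hθ : θ ∈ Ioo 0 (2 * π)) : 0 < 2 - 2 * cos θ := by
  rw [two_sub_two_cos]
  have := sin_half_pos hθ
  positivity

/-- Differentiate the cotangent series term by term and compare with the derivative of its closed
form; the term 1/θ accounts for j = 0. -/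
lemma latticeSum_two {θ : ℝ} (hθ : θ ∈ Ioo 0 (2 * π)) :
    latticeSum 2 θ = 1 / (2 - 2 * cos θ) := by
  obtain ⟨ε, hε, hεθ⟩ := exists_between (lt_min hθ.1 (by linarith [hθ.2] : 0 < 2 * π - θ))
  rw [lt_min_iff] at hεθ
  have hmem : θ ∈ Ioo ε (2 * π - ε) := ⟨hεθ.1, by linarith [hεθ.2]⟩
  have hsub : ∀ y ∈ Ioo ε (2 * π - ε), y ∈ Ioo 0 (2 * π) := fun y hy =>
    ⟨hε.trans hy.1, by linarith [hy.2]⟩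
  have hsum : ∀ n : ℕ, 2 ≤ n → Summable fun j : ℤ => (2 / ε) ^ n * (1 / (|(j : ℝ)| + 1) ^ n) :=
    fun n hn => (summable_one_div_abs_int_add_one_pow hn).mul_left _
  have hinj1 : Function.Injective fun n : ℕ => (-((n : ℤ) + 1) : ℤ) := fun a b h => by
    simp only at h; omega
  have hinj2 : Function.Injective fun n : ℕ => ((n : ℤ) + 1 : ℤ) := fun a b h => by
    simp only at h; omega
  have hs0 : Summable fun n : ℕ => (1 / (θ + 2 * ((-((n : ℤ) + 1) : ℤ) : ℝ) * π) ^ 1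
        + 1 / (θ + 2 * (((n : ℤ) + 1 : ℤ) : ℝ) * π) ^ 1) := by
    refine Summable.of_norm_bounded
      ((((summable_one_div_abs_int_add_one_pow le_rfl).comp_injective hinj2).mul_left
        (2 * θ * (2 / ε) ^ 2))) fun n => ?_
    have hne1 := shift_ne_zero hθ (-((n : ℤ) + 1))
    have hne2 := shift_ne_zero hθ ((n : ℤ) + 1)
    have b1 := abs_one_div_shift_pow_le hε hmem.1.le hmem.2.le 1 (-((n : ℤ) + 1))
    have b2 := abs_one_div_shift_pow_le hε hmem.1.le hmem.2.le 1 ((n : ℤ) + 1)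
    -- With a + b = 2θ, 1/a + 1/b = 2θ/(ab), which decays quadratically.
    have e : 1 / (θ + 2 * ((-((n : ℤ) + 1) : ℤ) : ℝ) * π) ^ 1
        + 1 / (θ + 2 * (((n : ℤ) + 1 : ℤ) : ℝ) * π) ^ 1
        = 2 * θ * (1 / (θ + 2 * ((-((n : ℤ) + 1) : ℤ) : ℝ) * π) ^ 1
          * (1 / (θ + 2 * (((n : ℤ) + 1 : ℤ) : ℝ) * π) ^ 1)) := by
      have hab : 2 * θ = (θ + 2 * ((-((n : ℤ) + 1) : ℤ) : ℝ) * π)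
          + (θ + 2 * (((n : ℤ) + 1 : ℤ) : ℝ) * π) := by
        push_cast
        ring
      rw [hab, pow_one, pow_one]
      generalize θ + 2 * ((-((n : ℤ) + 1) : ℤ) : ℝ) * π = a at hne1 ⊢
      generalize θ + 2 * (((n : ℤ) + 1 : ℤ) : ℝ) * π = b at hne2 ⊢
      field_simp
      ring
    rw [e, Real.norm_eq_abs, abs_mul (2 * θ), abs_mul (1 / _),
      abs_of_pos (by linarith [hθ.1] : 0 < 2 * θ)]
    have hθ' := hθ.1
    calc _ ≤ 2 * θ * (((2 / ε) ^ 1 * (1 / (|((-((n : ℤ) + 1) : ℤ) : ℝ)| + 1) ^ 1)) *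
          ((2 / ε) ^ 1 * (1 / (|(((n : ℤ) + 1 : ℤ) : ℝ)| + 1) ^ 1))) := by gcongr
      _ = _ := by
        simp only [Function.comp, Int.cast_neg, abs_neg]
        field_simp
  have hderiv := hasDerivAt_tsum_of_isPreconnected
    (g := fun (n : ℕ) (x : ℝ) => (1 / (x + 2 * ((-((n : ℤ) + 1) : ℤ) : ℝ) * π) ^ 1
        + 1 / (x + 2 * (((n : ℤ) + 1 : ℤ) : ℝ) * π) ^ 1))
    (g' := fun (n : ℕ) (x : ℝ) =>
      -((1 : ℕ) : ℝ) * (1 / (x + 2 * ((-((n : ℤ) + 1) : ℤ) : ℝ) * π) ^ (1 + 1))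
        + -((1 : ℕ) : ℝ) * (1 / (x + 2 * (((n : ℤ) + 1 : ℤ) : ℝ) * π) ^ (1 + 1)))
    (((hsum 2 le_rfl).comp_injective hinj1).add ((hsum 2 le_rfl).comp_injective hinj2))
    isOpen_Ioo isPreconnected_Ioo
    (fun n y hy => (hasDerivAt_one_div_shift_pow 1 (shift_ne_zero (hsub y hy) _)).add
      (hasDerivAt_one_div_shift_pow 1 (shift_ne_zero (hsub y hy) _)))
    (fun n y hy => by
      refine (norm_add_le _ _).trans (add_le_add ?_ ?_) <;>
      · rw [Nat.cast_one, neg_one_mul, norm_neg]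
        exact abs_one_div_shift_pow_le hε hy.1.le hy.2.le 2 _)
    hmem hs0 hmem
  have hsin := sin_half_pos hθ
  have hcot : HasDerivAt (fun x => cot (x / 2) / 2 - 1 / x)
      (-(1 / (2 - 2 * cos θ)) + 1 / θ ^ 2) θ := by
    have hhalf : HasDerivAt (fun x : ℝ => x / 2) (1 / 2) θ := (hasDerivAt_id θ).div_const 2
    have h1 := ((hhalf.cos.div hhalf.sin hsin.ne').div_const 2).sub
      ((hasDerivAt_id θ).inv hθ.1.ne')
    have e : (fun x : ℝ => cot (x / 2) / 2 - 1 / x) =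
        fun x => cos (x / 2) / sin (x / 2) / 2 - x⁻¹ := by
      funext x; rw [cot_eq_cos_div_sin, one_div]
    rw [e]
    refine h1.congr_deriv ?_
    have hθ0 := hθ.1.ne'
    rw [two_sub_two_cos]
    simp only [id]
    field_simp
    linear_combination (-4 : ℝ) * θ ^ 2 * (sin_sq_add_cos_sq (θ / 2))
  have heq := (hcot.congr_of_eventuallyEq (f₁ := fun x =>
      ∑' n : ℕ, (1 / (x + 2 * ((-((n : ℤ) + 1) : ℤ) : ℝ) * π) ^ 1
        + 1 / (x + 2 * (((n : ℤ) + 1 : ℤ) : ℝ) * π) ^ 1)) (by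
      filter_upwards [isOpen_Ioo.mem_nhds hθ] with x hx
      exact (cot_half_series hx).symm)).unique hderiv
  have hS := summable_latticeSum le_rfl hθ
  have hp : Summable fun n : ℕ => 1 / (θ + 2 * (((n : ℤ) + 1 : ℤ) : ℝ) * π) ^ 2 :=
    hS.comp_injective hinj2
  have hm : Summable fun n : ℕ => 1 / (θ + 2 * ((-((n : ℤ) + 1) : ℤ) : ℝ) * π) ^ 2 :=
    hS.comp_injective hinj1
  have hsplit := tsum_of_add_one_of_neg_add_one
    (f := fun j : ℤ => 1 / (θ + 2 * (j : ℝ) * π) ^ 2) hp hm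
  rw [(hm.mul_left _).tsum_add (hp.mul_left _), tsum_mul_left, tsum_mul_left] at heq
  unfold latticeSum
  rw [hsplit]
  simp only [Nat.cast_one, Int.cast_zero, mul_zero, zero_mul,
    add_zero] at heq ⊢
  linarith

/-! ### Monotonicity of ratios of lattice sums -/

lemma Ioc_zero_pi_subset : Ioc 0 π ⊆ Ioo 0 (2 * π) := fun _ hx =>
  ⟨hx.1, by linarith [hx.2, pi_pos]⟩

lemma Ioo_zero_pi_subset : Ioo 0 π ⊆ Ioo 0 (2 * π) := fun _ hx =>
  ⟨hx.1, by linarith [hx.2, pi_pos]⟩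

lemma pi_mem_Ioo : π ∈ Ioo 0 (2 * π) := Ioc_zero_pi_subset ⟨pi_pos, le_rfl⟩

/-- Half the numerator of the derivative of S_{2k}/S_{2k+2}. The weights k + 1 and k make the
S_{2k+1} S_{2k+3} terms cancel in its own derivative; Cauchy–Schwarz makes the remainder negative.
The expression thus decreases to its value 0 at π. -/
lemma latticeSum_wronskian_pos {k : ℕ} (hk : 1 ≤ k) {θ : ℝ} (hθ : θ ∈ Ioo 0 π) :
    0 < (k + 1) * (latticeSum (2 * k) θ * latticeSum (2 * k + 3) θ)
      - k * (latticeSum (2 * k + 1) θ * latticeSum (2 * k + 2) θ) := by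
  set E : ℝ → ℝ := fun θ => (k + 1) * (latticeSum (2 * k) θ * latticeSum (2 * k + 3) θ)
      - k * (latticeSum (2 * k + 1) θ * latticeSum (2 * k + 2) θ) with hE
  have hder : ∀ x ∈ Ioo 0 (2 * π), HasDerivAt E
      (k * (2 * k + 1) * latticeSum (2 * k + 2) x ^ 2
        - (k + 1) * (2 * k + 3) * (latticeSum (2 * k) x * latticeSum (2 * k + 4) x)) x := by
    intro x hx
    have h0 := hasDerivAt_latticeSum (by omega : 2 ≤ 2 * k) hx
    have h1 := hasDerivAt_latticeSum (by omega : 2 ≤ 2 * k + 1) hx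
    have h2 := hasDerivAt_latticeSum (by omega : 2 ≤ 2 * k + 2) hx
    have h3 := hasDerivAt_latticeSum (by omega : 2 ≤ 2 * k + 3) hx
    refine (((h0.mul h3).const_mul ((k : ℝ) + 1)).sub
      ((h1.mul h2).const_mul (k : ℝ))).congr_deriv ?_
    push_cast
    ring
  have hneg : ∀ x ∈ Ioo 0 (2 * π), k * (2 * k + 1) * latticeSum (2 * k + 2) x ^ 2
        - (k + 1) * (2 * k + 3) * (latticeSum (2 * k) x * latticeSum (2 * k + 4) x) < 0 := by
    intro x hx
    have hcs := latticeSum_sq_le hk hx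
    have hpos := mul_pos (latticeSum_even_pos hk hx)
      (latticeSum_even_pos (by omega : 1 ≤ k + 2) hx)
    rw [show 2 * (k + 2) = 2 * k + 4 by ring] at hpos
    have hk0 : (0 : ℝ) ≤ k * (2 * k + 1) := by positivity
    nlinarith [mul_le_mul_of_nonneg_left hcs hk0, mul_nonneg (Nat.cast_nonneg (α := ℝ) k) hpos.le]
  have hanti : StrictAntiOn E (Ioc 0 π) := by
    refine strictAntiOn_of_deriv_neg (convex_Ioc 0 π)
      (fun x hx => (hder x (Ioc_zero_pi_subset hx)).continuousAt.continuousWithinAt) ?_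
    intro x hx
    have hx' := Ioc_zero_pi_subset (interior_subset hx)
    rw [(hder x hx').deriv]
    exact hneg x hx'
  have h := hanti ⟨hθ.1, hθ.2.le⟩ ⟨pi_pos, le_rfl⟩ hθ.2
  have hπ : E π = 0 := by
    simp only [hE]
    rw [latticeSum_odd_pi (by exact ⟨k + 1, by ring⟩ : Odd (2 * k + 3)),
      latticeSum_odd_pi (by exact ⟨k, rfl⟩ : Odd (2 * k + 1))]
    ring
  rw [hπ] at h
  exact h

/-- The ratio of consecutive even lattice sums has positive derivative on `(0, π)`. -/
lemma exists_hasDerivAt_latticeSum_ratio {k : ℕ} (hk : 1 ≤ k) {θ : ℝ} (hθ : θ ∈ Ioo 0 π) :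
    ∃ d > 0, HasDerivAt (fun x => latticeSum (2 * k) x / latticeSum (2 * k + 2) x) d θ := by
  have hθ' := Ioo_zero_pi_subset hθ
  have hpos : 0 < latticeSum (2 * k + 2) θ := latticeSum_even_pos (by omega : 1 ≤ k + 1) hθ'
  have h0 := hasDerivAt_latticeSum (by omega : 2 ≤ 2 * k) hθ'
  have h2 := hasDerivAt_latticeSum (by omega : 2 ≤ 2 * k + 2) hθ'
  refine ⟨_, ?_, h0.div h2 hpos.ne'⟩
  have := latticeSum_wronskian_pos hk hθ
  apply div_pos _ (by positivity)
  push_cast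
  linarith

/-- The ratio telescopes into consecutive even ratios. Only d ≥ 0 is available, since for p = 0 it
is constantly 1. -/
lemma exists_hasDerivAt_latticeSum_two_div {p : ℕ} {θ : ℝ} (hθ : θ ∈ Ioo 0 π) :
    ∃ d ≥ 0, HasDerivAt (fun x => latticeSum 2 x / latticeSum (2 * p + 2) x) d θ := by
  have hθ' := Ioo_zero_pi_subset hθ
  have hev := isOpen_Ioo.mem_nhds hθ'
  induction p with
  | zero =>
    refine ⟨0, le_rfl, (hasDerivAt_const θ (1 : ℝ)).congr_of_eventuallyEq ?_⟩
    filter_upwards [hev] with x hx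
    exact div_self (latticeSum_even_pos le_rfl hx).ne'
  | succ p ih =>
    obtain ⟨d, hd, h⟩ := ih
    obtain ⟨e, he, h'⟩ := exists_hasDerivAt_latticeSum_ratio (by omega : 1 ≤ p + 1) hθ
    have p0 := latticeSum_even_pos le_rfl hθ'
    have p1 := latticeSum_even_pos (by omega : 1 ≤ p + 1) hθ'
    have p2 := latticeSum_even_pos (by omega : 1 ≤ p + 1 + 1) hθ'
    refine ⟨_, ?_, (h.mul h').congr_of_eventuallyEq ?_⟩
    · exact add_nonneg (mul_nonneg hd (div_pos p1 p2).le) (mul_nonneg (div_pos p0 p1).le he.le)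
    · filter_upwards [hev] with x hx
      have q1 := latticeSum_even_pos (by omega : 1 ≤ p + 1) hx
      exact (div_mul_div_cancel₀ q1.ne').symm

/-! ### Upper bounds near zero -/

lemma le_abs_shift {θ : ℝ} (hθ : θ ∈ Ioc 0 π) (j : ℤ) : θ ≤ |θ + 2 * (j : ℝ) * π| := by
  rcases le_or_gt 0 j with hj | hj
  · have hj' : (0 : ℝ) ≤ j := by exact_mod_cast hj
    exact le_trans (by nlinarith [pi_pos]) (le_abs_self _)
  · have hj' : (j : ℝ) ≤ -1 := by exact_mod_cast (by omega : j ≤ -1)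
    refine le_trans ?_ (neg_le_abs _)
    nlinarith [pi_pos, hθ.2]

/-- Every shift has modulus at least θ, so θ^(-2k) factors out; Jordan's inequality sin(θ/2) ≥ θ/π
bounds the remaining S_2. -/
lemma latticeSum_le {k : ℕ} {θ : ℝ} (hθ : θ ∈ Ioc 0 π) :
    latticeSum (2 * k + 2) θ ≤ π ^ 2 / 4 * (1 / θ ^ (2 * k + 2)) := by
  have hθ' := Ioc_zero_pi_subset hθ
  have h0 := hθ.1
  have hle : latticeSum (2 * k + 2) θ ≤ 1 / θ ^ (2 * k) * latticeSum 2 θ := by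
    unfold latticeSum
    rw [← tsum_mul_left]
    refine (summable_latticeSum (by omega) hθ').tsum_le_tsum (fun j => ?_)
      ((summable_latticeSum le_rfl hθ').mul_left _)
    rw [pow_add, one_div_mul_one_div_rev, mul_comm]
    have hne := shift_ne_zero hθ' j
    have : θ ^ (2 * k) ≤ (θ + 2 * (j : ℝ) * π) ^ (2 * k) := by
      rw [← (even_two_mul k).pow_abs (θ + 2 * (j : ℝ) * π)]
      exact pow_le_pow_left₀ h0.le (le_abs_shift hθ j) _
    gcongr
  have hsin : θ / π ≤ sin (θ / 2) := by
    have := mul_le_sin (x := θ / 2) (by linarith) (by linarith [hθ.2])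
    convert this using 1
    field_simp
  have h2 : latticeSum 2 θ ≤ π ^ 2 / 4 * (1 / θ ^ 2) := by
    rw [latticeSum_two hθ', two_sub_two_cos]
    calc 1 / (4 * sin (θ / 2) ^ 2) ≤ 1 / (4 * (θ / π) ^ 2) := by gcongr
      _ = _ := by field_simp
  calc latticeSum (2 * k + 2) θ ≤ 1 / θ ^ (2 * k) * latticeSum 2 θ := hle
    _ ≤ 1 / θ ^ (2 * k) * (π ^ 2 / 4 * (1 / θ ^ 2)) := by gcongr
    _ = _ := by rw [pow_add]; field_simp

/-! ### The symbols in terms of lattice sums -/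

lemma cos_ne_one {θ : ℝ} (hθ : θ ∈ Ioo 0 (2 * π)) : cos θ ≠ 1 := by
  have := two_sub_two_cos_pos hθ
  intro h
  rw [h] at this
  norm_num at this

lemma M_eq (p : ℕ) {θ : ℝ} (hθ : θ ∈ Ioo 0 (2 * π)) :
    M p θ = (2 - 2 * cos θ) ^ (p + 1) * latticeSum (2 * p + 2) θ := by
  rw [M, if_neg (cos_ne_one hθ), latticeSum]

lemma B_eq (p : ℕ) {θ : ℝ} (hθ : θ ∈ Ioo 0 (2 * π)) :
    B p θ = -((2 - 2 * cos θ) ^ (p + 1) * latticeSum (2 * p) θ) := by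
  rw [B, if_neg (cos_ne_one hθ), latticeSum]

lemma neg_one_pow_mul_D (p : ℕ) (θ : ℝ) : (-1) ^ p * D p θ = (2 - 2 * cos θ) ^ p := by
  rw [D, ← mul_assoc, ← mul_pow]
  norm_num

lemma M_pos (p : ℕ) {θ : ℝ} (hθ : θ ∈ Ioo 0 (2 * π)) : 0 < M p θ := by
  rw [M_eq p hθ]
  exact mul_pos (pow_pos (two_sub_two_cos_pos hθ) _)
    (latticeSum_even_pos (by omega : 1 ≤ p + 1) hθ)

lemma B_neg {p : ℕ} (hp : 1 ≤ p) {θ : ℝ} (hθ : θ ∈ Ioo 0 (2 * π)) : B p θ < 0 := by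
  rw [B_eq p hθ]
  exact neg_neg_of_pos (mul_pos (pow_pos (two_sub_two_cos_pos hθ) _) (latticeSum_even_pos hp hθ))

lemma F_eq (p : ℕ) (ρ δ : ℝ) {θ : ℝ} (hθ : θ ∈ Ioo 0 (2 * π)) :
    F p ρ δ θ = (2 - 2 * cos θ) ^ (p + 1) * (ρ * latticeSum (2 * p + 2) θ
      - latticeSum (2 * p) θ + ρ * δ * latticeSum 2 θ) := by
  have hw := (two_sub_two_cos_pos hθ).ne'
  rw [F, mul_assoc δ, neg_one_pow_mul_D, M_eq p hθ, B_eq p hθ, latticeSum_two hθ]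
  generalize 2 - 2 * cos θ = w at hw ⊢
  field_simp
  ring

/-- The quotient `F_p / M_p` expressed by lattice sums. -/
noncomputable def symbolRatio (p : ℕ) (ρ δ θ : ℝ) : ℝ :=
  ρ - latticeSum (2 * p) θ / latticeSum (2 * p + 2) θ
    + ρ * δ * (latticeSum 2 θ / latticeSum (2 * p + 2) θ)

lemma F_eq_mul_symbolRatio (p : ℕ) (ρ δ : ℝ) {θ : ℝ} (hθ : θ ∈ Ioo 0 (2 * π)) :
    F p ρ δ θ = M p θ * symbolRatio p ρ δ θ := by
  have h := (latticeSum_even_pos (by omega : 1 ≤ p + 1) hθ).ne'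
  rw [show 2 * (p + 1) = 2 * p + 2 by ring] at h
  rw [F_eq p ρ δ hθ, M_eq p hθ, symbolRatio]
  field_simp

lemma F_div_M_eq (p : ℕ) (ρ δ : ℝ) {θ : ℝ} (hθ : θ ∈ Ioo 0 (2 * π)) :
    F p ρ δ θ / M p θ = symbolRatio p ρ δ θ := by
  rw [F_eq_mul_symbolRatio p ρ δ hθ, mul_div_cancel_left₀ _ (M_pos p hθ).ne']

lemma F_eq_zero_iff (p : ℕ) (ρ δ : ℝ) {θ : ℝ} (hθ : θ ∈ Ioo 0 (2 * π)) :
    F p ρ δ θ = 0 ↔ symbolRatio p ρ δ θ = 0 := by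
  rw [F_eq_mul_symbolRatio p ρ δ hθ, mul_eq_zero, or_iff_right (M_pos p hθ).ne']

lemma exists_hasDerivAt_symbolRatio {p : ℕ} (hp : 1 ≤ p) {ρ δ : ℝ} (hρ : 0 < ρ) (hδ : δ ≤ 0)
    {θ : ℝ} (hθ : θ ∈ Ioo 0 π) : ∃ d < 0, HasDerivAt (symbolRatio p ρ δ) d θ := by
  obtain ⟨d, hd, h⟩ := exists_hasDerivAt_latticeSum_ratio hp hθ
  obtain ⟨e, he, h'⟩ := exists_hasDerivAt_latticeSum_two_div (p := p) hθ
  refine ⟨_, ?_, (h.const_sub ρ).add (h'.const_mul (ρ * δ))⟩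
  nlinarith [mul_nonneg (mul_nonneg hρ.le (neg_nonneg.2 hδ)) he]

lemma continuousOn_latticeSum {n : ℕ} (hn : 2 ≤ n) :
    ContinuousOn (latticeSum n) (Ioo 0 (2 * π)) := fun _ hx =>
  (hasDerivAt_latticeSum hn hx).continuousAt.continuousWithinAt

lemma continuousOn_symbolRatio {p : ℕ} (hp : 1 ≤ p) (ρ δ : ℝ) :
    ContinuousOn (symbolRatio p ρ δ) (Ioo 0 (2 * π)) := by
  have hne : ∀ x ∈ Ioo 0 (2 * π), latticeSum (2 * p + 2) x ≠ 0 := fun x hx =>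
    (latticeSum_even_pos (by omega : 1 ≤ p + 1) hx).ne'
  have h0 := continuousOn_latticeSum (by omega : 2 ≤ 2 * p)
  have h1 := continuousOn_latticeSum (by omega : 2 ≤ 2 * p + 2)
  have h2 := continuousOn_latticeSum (le_refl 2)
  exact (continuousOn_const.sub (h0.div h1 hne)).add (continuousOn_const.mul (h2.div h1 hne))

lemma strictAntiOn_symbolRatio {p : ℕ} (hp : 1 ≤ p) {ρ δ : ℝ} (hρ : 0 < ρ) (hδ : δ ≤ 0) :
    StrictAntiOn (symbolRatio p ρ δ) (Ioc 0 π) := by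
  refine strictAntiOn_of_deriv_neg (convex_Ioc 0 π)
    ((continuousOn_symbolRatio hp ρ δ).mono Ioc_zero_pi_subset) fun x hx => ?_
  rw [interior_Ioc] at hx
  obtain ⟨d, hd, h⟩ := exists_hasDerivAt_symbolRatio hp hρ hδ hx
  rwa [h.deriv]

/-- An explicit bound tending to ρ at 0, which replaces a limit computation. Numerators are bounded
by `latticeSum_le`, denominators from below by their j = 0 term. -/
lemma symbolRatio_lower_bound {p : ℕ} (hp : 1 ≤ p) {ρ δ : ℝ} (hρ : 0 < ρ) (hδ : δ ≤ 0)
    {θ : ℝ} (hθ : θ ∈ Ioc 0 π) :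
    ρ - π ^ 2 / 4 * θ ^ 2 + ρ * δ * (π ^ 2 / 4 * θ ^ (2 * p)) ≤ symbolRatio p ρ δ θ := by
  have hθ' := Ioc_zero_pi_subset hθ
  have h0 := hθ.1
  have key : ∀ k, latticeSum (2 * k + 2) θ / latticeSum (2 * p + 2) θ
      ≤ π ^ 2 / 4 * (1 / θ ^ (2 * k + 2)) * θ ^ (2 * p + 2) := by
    intro k
    have hlow : 1 / θ ^ (2 * p + 2) ≤ latticeSum (2 * p + 2) θ :=
      one_div_pow_le_latticeSum (by omega : 1 ≤ p + 1) hθ'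
    have hpos : 0 < latticeSum (2 * p + 2) θ := latticeSum_even_pos (by omega : 1 ≤ p + 1) hθ'
    rw [div_le_iff₀ hpos, mul_assoc]
    refine (latticeSum_le hθ).trans (le_mul_of_one_le_right (by positivity) ?_)
    calc (1 : ℝ) = θ ^ (2 * p + 2) * (1 / θ ^ (2 * p + 2)) := by field_simp
      _ ≤ _ := by gcongr
  have k1 := key (p - 1)
  have k0 := key 0
  rw [show 2 * (p - 1) + 2 = 2 * p by omega] at k1
  have e1 : π ^ 2 / 4 * (1 / θ ^ (2 * p)) * θ ^ (2 * p + 2) = π ^ 2 / 4 * θ ^ 2 := by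
    rw [pow_add]; field_simp
  have e0 : π ^ 2 / 4 * (1 / θ ^ (2 * 0 + 2)) * θ ^ (2 * p + 2) = π ^ 2 / 4 * θ ^ (2 * p) := by
    rw [mul_zero, zero_add, pow_add]; field_simp
  rw [e1] at k1
  rw [e0] at k0
  have := mul_le_mul_of_nonpos_left k0 (mul_nonpos_of_nonneg_of_nonpos hρ.le hδ)
  unfold symbolRatio
  simp only [mul_zero, zero_add] at this
  linarith

lemma exists_symbolRatio_pos {p : ℕ} (hp : 1 ≤ p) {ρ δ : ℝ} (hρ : 0 < ρ) (hδ : δ ≤ 0) :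
    ∃ θ ∈ Ioo 0 π, 0 < symbolRatio p ρ δ θ := by
  have hcont : Continuous fun θ : ℝ =>
      ρ - π ^ 2 / 4 * θ ^ 2 + ρ * δ * (π ^ 2 / 4 * θ ^ (2 * p)) := by fun_prop
  have hev : ∀ᶠ θ in nhds (0 : ℝ),
      0 < ρ - π ^ 2 / 4 * θ ^ 2 + ρ * δ * (π ^ 2 / 4 * θ ^ (2 * p)) := by
    refine hcont.continuousAt.eventually (lt_mem_nhds ?_)
    simpa [show p ≠ 0 by omega] using hρ
  have hev' := (hev.filter_mono nhdsWithin_le_nhds).and (Ioo_mem_nhdsGT pi_pos)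
  obtain ⟨θ, h1, h2⟩ := hev'.exists
  exact ⟨θ, h2, h1.trans_le (symbolRatio_lower_bound hp hρ hδ ⟨h2.1, h2.2.le⟩)⟩

/-! ### Symmetries and zeros of F -/

lemma F_neg (p : ℕ) (ρ δ θ : ℝ) : F p ρ δ (-θ) = F p ρ δ θ := by
  have h0 := latticeSum_even_neg p θ
  have h1 := latticeSum_even_neg (p + 1) θ
  unfold latticeSum at h0 h1
  rw [show 2 * (p + 1) = 2 * p + 2 by ring] at h1
  simp only [F, M, B, D, cos_neg, h0, h1]

lemma F_add_two_pi (p : ℕ) (ρ δ θ : ℝ) : F p ρ δ (θ + 2 * π) = F p ρ δ θ := by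
  have h0 := latticeSum_add_two_pi (2 * p) θ
  have h1 := latticeSum_add_two_pi (2 * p + 2) θ
  unfold latticeSum at h0 h1
  simp only [F, M, B, D, cos_add_two_pi, h0, h1]

lemma F_zero {p : ℕ} (hp : 1 ≤ p) (ρ δ : ℝ) : F p ρ δ 0 = ρ := by
  simp [F, M, B, D, show p ≠ 0 by omega]

lemma deriv_F_neg (p : ℕ) (ρ δ θ : ℝ) : deriv (F p ρ δ) (-θ) = -deriv (F p ρ δ) θ := by
  have h := deriv_comp_neg (F p ρ δ) θ
  simp only [F_neg] at h
  rw [h, neg_neg]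

/-- Evenness and periodicity make F symmetric about π. -/
lemma deriv_F_pi (p : ℕ) (ρ δ : ℝ) : deriv (F p ρ δ) π = 0 := by
  have h := deriv_comp_const_sub (F p ρ δ) (2 * π) π
  have e : (fun x => F p ρ δ (2 * π - x)) = F p ρ δ := by
    funext x
    rw [show 2 * π - x = -x + 2 * π by ring, F_add_two_pi, F_neg]
  rw [e, show 2 * π - π = π by ring] at h
  linarith

lemma zerosOn_F_eq {p : ℕ} (hp : 1 ≤ p) {ρ δ : ℝ} (hρ : 0 < ρ) :
    zerosOn (F p ρ δ) = {θ | |θ| ∈ Ioc 0 π ∧ symbolRatio p ρ δ |θ| = 0} := by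
  ext θ
  have habs : F p ρ δ |θ| = F p ρ δ θ := by
    rcases abs_choice θ with h | h <;> rw [h]
    exact F_neg ..
  simp only [zerosOn, mem_ofPred_eq, mem_Icc, ← abs_le]
  constructor
  · rintro ⟨h1, h2⟩
    have hpos : 0 < |θ| := by
      rw [abs_pos]
      rintro rfl
      rw [F_zero hp] at h2
      exact hρ.ne' h2
    exact ⟨⟨hpos, h1⟩, (F_eq_zero_iff p ρ δ (Ioc_zero_pi_subset ⟨hpos, h1⟩)).1 (habs.trans h2)⟩
  · rintro ⟨h1, h2⟩
    exact ⟨h1.2, habs ▸ (F_eq_zero_iff p ρ δ (Ioc_zero_pi_subset h1)).2 h2⟩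

lemma zerosOn_F_eq_pair {p : ℕ} (hp : 1 ≤ p) {ρ δ : ℝ} (hρ : 0 < ρ) (hδ : δ ≤ 0) {a : ℝ}
    (ha : a ∈ Ioc 0 π) (hz : symbolRatio p ρ δ a = 0) : zerosOn (F p ρ δ) = {-a, a} := by
  rw [zerosOn_F_eq hp hρ]
  ext θ
  simp only [mem_ofPred_eq, mem_insert_iff, mem_singleton_iff]
  have haa := abs_of_pos ha.1
  constructor
  · rintro ⟨h1, h2⟩
    have := (strictAntiOn_symbolRatio hp hρ hδ).injOn h1 ha (h2.trans hz.symm)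
    rw [← haa, abs_eq_abs] at this
    exact this.symm
  · rintro (rfl | rfl)
    · rw [abs_neg, haa]; exact ⟨ha, hz⟩
    · rw [haa]; exact ⟨ha, hz⟩

lemma hasExactlyTwoZeros_of_eq_pair {f : ℝ → ℝ} {a : ℝ} (ha : 0 < a)
    (h : zerosOn f = {-a, a}) : HasExactlyTwoZeros f := by
  rw [HasExactlyTwoZeros, h]
  exact encard_pair (by linarith)

lemma hasExactlyTwoSimpleZeros_F {p : ℕ} (hp : 1 ≤ p) {ρ δ : ℝ} (hρ : 0 < ρ) (hδ : δ ≤ 0)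
    (hπ : symbolRatio p ρ δ π < 0) : HasExactlyTwoSimpleZeros (F p ρ δ) := by
  obtain ⟨x, hx, hxpos⟩ := exists_symbolRatio_pos hp hρ hδ
  have hcont : ContinuousOn (symbolRatio p ρ δ) (Icc x π) :=
    (continuousOn_symbolRatio hp ρ δ).mono fun y hy =>
      Ioc_zero_pi_subset ⟨hx.1.trans_le hy.1, hy.2⟩
  obtain ⟨a, ha, haz⟩ := intermediate_value_Ioo' hx.2.le hcont ⟨hπ, hxpos⟩
  have ha' : a ∈ Ioo 0 π := ⟨hx.1.trans ha.1, ha.2⟩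
  have hpair := zerosOn_F_eq_pair hp hρ hδ ⟨ha'.1, ha'.2.le⟩ haz
  have ha2 := Ioo_zero_pi_subset ha'
  have hder : deriv (F p ρ δ) a ≠ 0 := by
    obtain ⟨d, hd, h⟩ := exists_hasDerivAt_symbolRatio hp hρ hδ ha'
    have hM : DifferentiableAt ℝ (M p) a := by
      have hw : DifferentiableAt ℝ (fun x => (2 - 2 * cos x) ^ (p + 1)) a := by fun_prop
      refine (hw.mul (hasDerivAt_latticeSum (by omega : 2 ≤ 2 * p + 2)
        ha2).differentiableAt).congr_of_eventuallyEq ?_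
      filter_upwards [isOpen_Ioo.mem_nhds ha2] with x hx using M_eq p hx
    have hF := (hM.hasDerivAt.mul h).congr_of_eventuallyEq (f₁ := F p ρ δ) (by
      filter_upwards [isOpen_Ioo.mem_nhds ha2] with x hx using F_eq_mul_symbolRatio p ρ δ hx)
    -- At a zero of the ratio only M times its derivative survives in the product rule.
    rw [hF.deriv, haz, mul_zero, zero_add]
    exact (mul_neg_of_pos_of_neg (M_pos p ha2) hd).ne
  refine ⟨hasExactlyTwoZeros_of_eq_pair ha'.1 hpair, ?_⟩
  rw [hpair]
  rintro θ (rfl | rfl)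
  · rw [deriv_F_neg]
    exact neg_ne_zero.2 hder
  · exact hder

lemma not_hasExactlyTwoSimpleZeros_F {p : ℕ} {ρ δ : ℝ} (h : F p ρ δ π = 0) :
    ¬ HasExactlyTwoSimpleZeros (F p ρ δ) := fun hz =>
  hz.2 π ⟨⟨by linarith [pi_pos], le_rfl⟩, h⟩ (deriv_F_pi p ρ δ)

lemma not_hasExactlyTwoZeros_F {p : ℕ} (hp : 1 ≤ p) {ρ δ : ℝ} (hρ : 0 < ρ) (hδ : δ ≤ 0)
    (hπ : 0 < symbolRatio p ρ δ π) : ¬ HasExactlyTwoZeros (F p ρ δ) := by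
  have : zerosOn (F p ρ δ) = ∅ := by
    rw [zerosOn_F_eq hp hρ, eq_empty_iff_forall_notMem]
    rintro θ ⟨h1, h2⟩
    have := (strictAntiOn_symbolRatio hp hρ hδ).antitoneOn h1 ⟨pi_pos, le_rfl⟩ h1.2
    linarith
  rw [HasExactlyTwoZeros, this, encard_empty]
  norm_num

/-! ### Critical parameters -/

lemma rhoCrit_eq (p : ℕ) : rhoCrit p = latticeSum (2 * p) π / latticeSum (2 * p + 2) π := by
  have hw := (pow_pos (two_sub_two_cos_pos pi_mem_Ioo) (p + 1)).ne'
  rw [rhoCrit, M_eq p pi_mem_Ioo, B_eq p pi_mem_Ioo, neg_div, neg_neg,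
    mul_div_mul_left _ _ hw]

lemma rhoCrit_pos {p : ℕ} (hp : 1 ≤ p) : 0 < rhoCrit p := by
  rw [rhoCrit_eq]
  exact div_pos (latticeSum_even_pos hp pi_mem_Ioo)
    (latticeSum_even_pos (by omega : 1 ≤ p + 1) pi_mem_Ioo)

lemma symbolRatio_pi_zero (p : ℕ) (ρ : ℝ) : symbolRatio p ρ 0 π = ρ - rhoCrit p := by
  rw [symbolRatio, rhoCrit_eq]
  ring

lemma F_pi (p : ℕ) (ρ δ : ℝ) : F p ρ δ π = B p π + ρ * (4 ^ p * (δ - deltaCrit p)) := by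
  rw [F, deltaCrit, mul_assoc δ, neg_one_pow_mul_D, cos_pi,
    show (2 - 2 * -1 : ℝ) = 4 by norm_num]
  field_simp
  ring

lemma deltaCrit_neg (p : ℕ) : deltaCrit p < 0 := by
  rw [deltaCrit, neg_one_pow_mul_D, neg_neg_iff_pos]
  exact div_pos (M_pos p pi_mem_Ioo) (pow_pos (two_sub_two_cos_pos pi_mem_Ioo) p)

lemma forall_hasExactlyTwoSimpleZeros_iff {p : ℕ} (hp : 1 ≤ p) (δ : ℝ) :
    (∀ ρ : ℝ, 0 < ρ → HasExactlyTwoSimpleZeros (F p ρ δ)) ↔ δ ≤ deltaCrit p := by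
  have hB := B_neg hp pi_mem_Ioo
  have h4 : (0 : ℝ) < 4 ^ p := by positivity
  constructor
  · intro h
    by_contra! hlt
    have hpos : 0 < 4 ^ p * (δ - deltaCrit p) := mul_pos h4 (sub_pos.2 hlt)
    -- This ρ solves F(π) = 0, which is linear in ρ with positive slope.
    refine not_hasExactlyTwoSimpleZeros_F ?_
      (h (-B p π / (4 ^ p * (δ - deltaCrit p))) (div_pos (neg_pos.2 hB) hpos))
    rw [F_pi, div_mul_cancel₀ _ hpos.ne']
    ring
  · intro hδ ρ hρ
    refine hasExactlyTwoSimpleZeros_F hp hρ (hδ.trans (deltaCrit_neg p).le) ?_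
    rw [← F_div_M_eq p ρ δ pi_mem_Ioo]
    refine div_neg_of_neg_of_pos ?_ (M_pos p pi_mem_Ioo)
    rw [F_pi]
    have : ρ * (4 ^ p * (δ - deltaCrit p)) ≤ 0 :=
      mul_nonpos_of_nonneg_of_nonpos hρ.le
        (mul_nonpos_of_nonneg_of_nonpos h4.le (sub_nonpos.2 hδ))
    linarith

lemma zerosOn_F_rhoCrit {p : ℕ} (hp : 1 ≤ p) : zerosOn (F p (rhoCrit p) 0) = {-π, π} :=
  zerosOn_F_eq_pair hp (rhoCrit_pos hp) le_rfl ⟨pi_pos, le_rfl⟩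
    (by rw [symbolRatio_pi_zero, sub_self])

lemma F_rhoCrit_pi {p : ℕ} (hp : 1 ≤ p) : F p (rhoCrit p) 0 π = 0 := by
  have : π ∈ zerosOn (F p (rhoCrit p) 0) := by
    rw [zerosOn_F_rhoCrit hp]
    exact Or.inr rfl
  exact this.2

lemma hasExactlyTwoZeros_iff {p : ℕ} (hp : 1 ≤ p) {ρ : ℝ} (hρ : 0 < ρ) :
    HasExactlyTwoZeros (F p ρ 0) ↔ ρ ≤ rhoCrit p := by
  have hr := symbolRatio_pi_zero p ρ
  constructor
  · intro h
    by_contra! hlt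
    exact not_hasExactlyTwoZeros_F hp hρ le_rfl (by linarith) h
  · intro h
    rcases h.lt_or_eq with h | rfl
    · exact (hasExactlyTwoSimpleZeros_F hp hρ le_rfl (by linarith)).1
    · exact hasExactlyTwoZeros_of_eq_pair pi_pos (zerosOn_F_rhoCrit hp)

lemma hasExactlyTwoSimpleZeros_iff {p : ℕ} (hp : 1 ≤ p) {ρ : ℝ} (hρ : 0 < ρ) :
    HasExactlyTwoSimpleZeros (F p ρ 0) ↔ ρ < rhoCrit p := by
  have hr := symbolRatio_pi_zero p ρ
  constructor
  · intro h
    refine ((hasExactlyTwoZeros_iff hp hρ).1 h.1).lt_of_ne ?_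
    rintro rfl
    exact not_hasExactlyTwoSimpleZeros_F (F_rhoCrit_pi hp) h
  · intro h
    exact hasExactlyTwoSimpleZeros_F hp hρ le_rfl (by linarith)

/-- With F = W H near π, both H and H' vanish at π, so F''(π) = W(π) H''(π). Cauchy–Schwarz gives ρ
S_{2p+4} ≥ S_{2p+2}, whence H''(π) ≥ (8p + 6) S_{2p+2}(π) > 0. -/
lemma iteratedDeriv_two_F_rhoCrit_pi_pos {p : ℕ} (hp : 1 ≤ p) :
    0 < iteratedDeriv 2 (F p (rhoCrit p) 0) π := by
  set ρ := rhoCrit p with hρ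
  have hρpos : 0 < ρ := rhoCrit_pos hp
  set W : ℝ → ℝ := fun x => (2 - 2 * cos x) ^ (p + 1) with hW
  set H : ℝ → ℝ := fun x => ρ * latticeSum (2 * p + 2) x - latticeSum (2 * p) x with hH
  set H' : ℝ → ℝ := fun x => ρ * (-((2 * p + 2 : ℕ) : ℝ) * latticeSum (2 * p + 2 + 1) x)
    - -((2 * p : ℕ) : ℝ) * latticeSum (2 * p + 1) x with hH'
  have hWd : Differentiable ℝ W := by fun_prop
  have hWd' : Differentiable ℝ (deriv W) := by
    have : ContDiff ℝ (1 + 1) W := by fun_prop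
    exact (contDiff_succ_iff_deriv.1 this).2.2.differentiable one_ne_zero
  have hHd : ∀ x ∈ Ioo 0 (2 * π), HasDerivAt H (H' x) x := fun x hx =>
    ((hasDerivAt_latticeSum (by omega : 2 ≤ 2 * p + 2) hx).const_mul ρ).sub
      (hasDerivAt_latticeSum (by omega : 2 ≤ 2 * p) hx)
  have hHd' := (((hasDerivAt_latticeSum (by omega : 2 ≤ 2 * p + 2 + 1) pi_mem_Ioo).const_mul
      (-((2 * p + 2 : ℕ) : ℝ))).const_mul ρ).sub
      ((hasDerivAt_latticeSum (by omega : 2 ≤ 2 * p + 1) pi_mem_Ioo).const_mul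
        (-((2 * p : ℕ) : ℝ)))
  have hFd : deriv (F p ρ 0) =ᶠ[nhds π] fun x => deriv W x * H x + W x * H' x := by
    filter_upwards [isOpen_Ioo.mem_nhds pi_mem_Ioo] with x hx
    refine (((hWd x).hasDerivAt.mul (hHd x hx)).congr_of_eventuallyEq ?_).deriv
    filter_upwards [isOpen_Ioo.mem_nhds hx] with y hy
    rw [F_eq p ρ 0 hy]
    simp [hW, hH]
  have hS2 : 0 < latticeSum (2 * p + 2) π :=
    latticeSum_even_pos (by omega : 1 ≤ p + 1) pi_mem_Ioo
  have hρS : ρ * latticeSum (2 * p + 2) π = latticeSum (2 * p) π := by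
    rw [hρ, rhoCrit_eq, div_mul_cancel₀ _ hS2.ne']
  have hHπ : H π = 0 := by rw [hH]; simp only; rw [hρS, sub_self]
  have hH'π : H' π = 0 := by
    simp only [hH']
    rw [latticeSum_odd_pi ⟨p + 1, by ring⟩, latticeSum_odd_pi ⟨p, rfl⟩]
    ring
  have hder := (((hWd' π).hasDerivAt.mul (hHd π pi_mem_Ioo)).add
    ((hWd π).hasDerivAt.mul hHd')).congr_of_eventuallyEq hFd
  rw [iteratedDeriv_succ, iteratedDeriv_one, hder.deriv]
  change 0 < _ * H π + _ * H' π + (_ * H' π + W π * _)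
  rw [hHπ, hH'π]
  simp only [mul_zero, zero_add]
  refine mul_pos (pow_pos (two_sub_two_cos_pos pi_mem_Ioo) _) ?_
  have hcs := latticeSum_sq_le hp pi_mem_Ioo
  have hle : latticeSum (2 * p + 2) π ≤ ρ * latticeSum (2 * p + 4) π := by
    rw [← hρS] at hcs
    nlinarith
  push_cast
  rw [show 2 * p + 2 + 1 + 1 = 2 * p + 4 by ring, show 2 * p + 1 + 1 = 2 * p + 2 by ring]
  have hp0 : (0 : ℝ) ≤ p := Nat.cast_nonneg p
  have hc : (0 : ℝ) ≤ (2 * p + 2) * (2 * p + 3) := by positivity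
  nlinarith [mul_le_mul_of_nonneg_left hle hc, mul_nonneg hp0 hS2.le]

lemma iteratedDeriv_two_F_neg (p : ℕ) (ρ δ θ : ℝ) :
    iteratedDeriv 2 (F p ρ δ) (-θ) = iteratedDeriv 2 (F p ρ δ) θ := by
  have h := iteratedDeriv_comp_neg 2 (F p ρ δ) θ
  simp only [F_neg] at h
  simpa using h.symm

end SplineSymbol

theorem lemma5p9 (p : ℕ) (hp : 1 ≤ p) :
    (∀ δ : ℝ,
      (∀ ρ : ℝ, 0 < ρ → SplineSymbol.HasExactlyTwoSimpleZeros (SplineSymbol.F p ρ δ)) ↔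
        δ ≤ SplineSymbol.deltaCrit p) ∧
    (∀ ρ : ℝ, 0 < ρ →
      (SplineSymbol.HasExactlyTwoZeros (SplineSymbol.F p ρ 0) ↔ ρ ≤ SplineSymbol.rhoCrit p) ∧
      (SplineSymbol.HasExactlyTwoSimpleZeros (SplineSymbol.F p ρ 0) ↔
        ρ < SplineSymbol.rhoCrit p)) ∧
    (SplineSymbol.zerosOn (SplineSymbol.F p (SplineSymbol.rhoCrit p) 0) =
        {-Real.pi, Real.pi} ∧
      ∀ θ ∈ ({-Real.pi, Real.pi} : Set ℝ),
        deriv (SplineSymbol.F p (SplineSymbol.rhoCrit p) 0) θ = 0 ∧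
        iteratedDeriv 2 (SplineSymbol.F p (SplineSymbol.rhoCrit p) 0) θ ≠ 0) ∧
    (∀ ρ δ : ℝ, 0 < ρ → δ ≤ 0 →
      StrictAntiOn (fun θ => SplineSymbol.F p ρ δ θ / SplineSymbol.M p θ)
        (Set.Ioo 0 Real.pi)) := by
  refine ⟨SplineSymbol.forall_hasExactlyTwoSimpleZeros_iff hp, fun ρ hρ =>
    ⟨SplineSymbol.hasExactlyTwoZeros_iff hp hρ, SplineSymbol.hasExactlyTwoSimpleZeros_iff hp hρ⟩,
    ⟨SplineSymbol.zerosOn_F_rhoCrit hp, ?_⟩, fun ρ δ hρ hδ => ?_⟩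
  · have h2 := (SplineSymbol.iteratedDeriv_two_F_rhoCrit_pi_pos hp).ne'
    rintro θ (rfl | rfl)
    · rw [SplineSymbol.deriv_F_neg, SplineSymbol.deriv_F_pi,
        SplineSymbol.iteratedDeriv_two_F_neg]
      exact ⟨neg_zero, h2⟩
    · exact ⟨SplineSymbol.deriv_F_pi _ _ _, h2⟩
  · exact ((SplineSymbol.strictAntiOn_symbolRatio hp hρ hδ).mono Set.Ioo_subset_Ioc_self).congr
      fun θ hθ => (SplineSymbol.F_div_M_eq p ρ δ (SplineSymbol.Ioo_zero_pi_subset hθ)).symm
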